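/- Let $\tau(n)=\sum_{d\mid n}1$ denote the number of positive divisors of a positive integer $n$, and for real $x$ let $$N^{\times}_{\tau}(x)=\#\{n\in\mathbb{N}: 1\le n\le x,\ n=k\tau(k)\text{ for some positive integer }k\}.$$ Then $N^{\times}_{\tau}(x)\asymp x/(\log x)^{1/2}$; that is, there exist absolute constants $c,C>0$ such that for all real $x\ge 2$, $$c\,\frac{x}{(\log x)^{1/2}}\le N^{\times}_{\tau}(x)\le C\,\frac{x}{(\log x)^{1/2}}.$$ -/

import Mathlib

/-- The divisor function `τ(n) = ∑_{d ∣ n} 1`, the number of positive divisors of `n`. -/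
def tau (n : ℕ) : ℕ := n.divisors.card

/-- The set of positive integers `n ≤ x` of the form `n = k f(k)` for some positive integer `k`. -/
def timesSet (f : ℕ → ℕ) (x : ℝ) : Set ℕ :=
  {n : ℕ | 1 ≤ n ∧ (n : ℝ) ≤ x ∧ ∃ k : ℕ, 1 ≤ k ∧ n = k * f k}

/-- The set being counted is finite, so its `Set.ncard` is its true cardinality. -/
theorem timesSet_finite (f : ℕ → ℕ) (x : ℝ) : (timesSet f x).Finite :=
  (Set.finite_Iic ⌊x⌋₊).subset fun _ hn => Nat.le_floor hn.2.1

/-- The counting function `N^×_f(x) = #{n ≤ x : n = k f(k) for some k}`. -/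
noncomputable def NTimes (f : ℕ → ℕ) (x : ℝ) : ℕ := (timesSet f x).ncard

open Finset ArithmeticFunction

/-! Both bounds rest on S = ∑ 1/(m τ(m)) having order √(log x): squaring S and grouping pairs by
their product n gives about τ(n) terms of size 1/(n τ(n)), hence a harmonic sum. Upper bound: it
suffices to count k with k τ(k) ≤ x. Expanding log k = ∑ Λ(d) over k = d m, Chebyshev's bound on
`Chebyshev.psi` gives ∑ log k ≪ x S, and almost all k have log k of order log x
(`sum_log_tauIndices_le`, `card_tauIndices_mul_log_le`). Lower bound: use k = m p with m odd
squarefree and small, p a large prime, so that k τ(k) = 2 p m τ(m). These values are distinct, and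
Chebyshev's lower bound for primes yields ≫ (x / log x) S of them (`NTimes_tau_ge_sum`,
`NTimes_tau_ge_of_large`). -/

theorem tau_pos {n : ℕ} (hn : n ≠ 0) : 0 < tau n :=
  card_pos.2 ⟨1, Nat.one_mem_divisors.2 hn⟩

theorem tau_mul_le (a b : ℕ) : tau (a * b) ≤ tau a * tau b := by
  classical
  unfold tau
  rw [Nat.divisors_mul]
  exact card_mul_le

theorem tau_le_tau_mul {a b : ℕ} (ha : a ≠ 0) (hb : b ≠ 0) : tau b ≤ tau (a * b) :=
  card_le_card (Nat.divisors_subset_of_dvd (mul_ne_zero ha hb) (dvd_mul_left b a))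

theorem tau_le_self (n : ℕ) : tau n ≤ n := Nat.card_divisors_le_self n

/-- A sum over pairs, grouped by the product of the pair. -/
theorem sum_product_eq_sum_divisorsAntidiagonal (S : Finset (ℕ × ℕ)) (T : Finset ℕ)
    (hST : ∀ p ∈ S, p.1 * p.2 ∈ T) (hT : ∀ n ∈ T, n ≠ 0) (f : ℕ × ℕ → ℝ) :
    ∑ p ∈ S, f p = ∑ n ∈ T, ∑ p ∈ n.divisorsAntidiagonal with p ∈ S, f p := by
  rw [← sum_fiberwise_of_maps_to hST f]
  refine sum_congr rfl fun n hn => sum_congr ?_ fun _ _ => rfl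
  ext p
  simp only [mem_filter, Nat.mem_divisorsAntidiagonal]
  have := hT n hn
  tauto

theorem sum_Icc_inv_eq_harmonic (N : ℕ) : ∑ n ∈ Icc 1 N, (1 / n : ℝ) = (harmonic N : ℝ) := by
  rw [harmonic_eq_sum_Icc]
  push_cast
  exact sum_congr rfl fun n _ => one_div _

/-- By submultiplicativity of `tau`, each of the at most `tau n` pairs with product `n` contributes
at most `1 / (n * tau n)`. -/
theorem sq_sum_inv_mul_tau_le (N : ℕ) :
    (∑ k ∈ Icc 1 N, 1 / ((k * tau k : ℕ) : ℝ)) ^ 2 ≤ 1 + 2 * Real.log N := by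
  have hmem : ∀ p ∈ Icc 1 N ×ˢ Icc 1 N, p.1 * p.2 ∈ Icc 1 (N ^ 2) := by
    rintro ⟨a, b⟩ hp
    simp only [mem_product, mem_Icc] at hp ⊢
    exact ⟨Nat.mul_pos hp.1.1 hp.2.1, by rw [sq]; exact Nat.mul_le_mul hp.1.2 hp.2.2⟩
  rw [sq, sum_mul_sum, ← sum_product',
    sum_product_eq_sum_divisorsAntidiagonal _ _ hmem (fun n hn => by simp at hn; omega)]
  calc _ ≤ ∑ n ∈ Icc 1 (N ^ 2), (1 / n : ℝ) := ?_
    _ ≤ 1 + Real.log (N ^ 2 : ℕ) := by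
        rw [sum_Icc_inv_eq_harmonic]; exact harmonic_le_one_add_log _
    _ = _ := by push_cast; rw [Real.log_pow]; norm_num
  refine sum_le_sum fun n hn => ?_
  have hn0 : n ≠ 0 := by simp at hn; omega
  have ht : (0 : ℝ) < tau n := by exact_mod_cast tau_pos hn0
  have hnpos : (0 : ℝ) < n := by positivity
  calc _ ≤ ∑ p ∈ n.divisorsAntidiagonal with p ∈ Icc 1 N ×ˢ Icc 1 N,
        (1 / (n * tau n) : ℝ) := by
        refine sum_le_sum fun p hp => ?_
        simp only [mem_filter, Nat.mem_divisorsAntidiagonal] at hp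
        rw [← hp.1.1, one_div_mul_one_div, ← Nat.cast_mul, ← Nat.cast_mul]
        refine one_div_le_one_div_of_le ?_ ?_
        · have := Nat.pos_of_ne_zero (hp.1.1 ▸ hn0)
          have := tau_pos (n := p.1 * p.2) this.ne'
          exact_mod_cast Nat.mul_pos ‹_› ‹_›
        · rw [mul_mul_mul_comm]
          exact_mod_cast Nat.mul_le_mul_left (p.1 * p.2) (tau_mul_le p.1 p.2)
    _ ≤ ∑ p ∈ n.divisorsAntidiagonal, (1 / (n * tau n) : ℝ) :=
        sum_le_sum_of_subset_of_nonneg (filter_subset _ _) fun _ _ _ => by positivity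
    _ = 1 / n := by
        rw [sum_const, ← Nat.map_div_right_divisors, card_map, nsmul_eq_mul]
        change (tau n : ℝ) * _ = _
        field_simp

/-! ### Upper bound -/

/-- The positive integers `k` with `k τ(k) ≤ x`. -/
noncomputable def tauIndices (x : ℝ) : Finset ℕ :=
  (Icc 1 ⌊x⌋₊).filter fun k => ((k * tau k : ℕ) : ℝ) ≤ x

theorem mem_tauIndices {x : ℝ} {k : ℕ} :
    k ∈ tauIndices x ↔ 1 ≤ k ∧ ((k * tau k : ℕ) : ℝ) ≤ x := by
  simp only [tauIndices, mem_filter, mem_Icc, and_congr_left_iff, and_iff_left_iff_imp]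
  intro h hk
  refine Nat.le_floor (le_trans ?_ h)
  exact_mod_cast Nat.le_mul_of_pos_right k (tau_pos (by omega))

theorem timesSet_tau_eq_image (x : ℝ) :
    timesSet tau x = (tauIndices x).image fun k => k * tau k := by
  ext n
  simp only [timesSet, Set.mem_ofPred_eq, coe_image, Set.mem_image, mem_coe, mem_tauIndices]
  constructor
  · rintro ⟨-, hx, k, hk, rfl⟩
    exact ⟨k, ⟨hk, hx⟩, rfl⟩
  · rintro ⟨k, ⟨hk, hx⟩, rfl⟩
    exact ⟨Nat.mul_pos hk (tau_pos (by omega)), hx, k, hk, rfl⟩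

theorem NTimes_tau_le_card (x : ℝ) : NTimes tau x ≤ #(tauIndices x) := by
  rw [NTimes, timesSet_tau_eq_image, Set.ncard_coe_finset]
  exact card_image_le

/-- If k = d m then τ(m) ≤ τ(k), so k τ(k) ≤ x forces d ≤ x / (m τ(m)); the sum of Λ over such d is
at most a value of `Chebyshev.psi`. -/
theorem sum_log_tauIndices_le (x : ℝ) :
    ∑ k ∈ tauIndices x, Real.log k ≤
      ∑ m ∈ tauIndices x, Chebyshev.psi (x / ((m * tau m : ℕ) : ℝ)) := by
  set P := (Icc 1 ⌊x⌋₊ ×ˢ tauIndices x).filter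
    fun p : ℕ × ℕ => p.1 * ((p.2 * tau p.2 : ℕ) : ℝ) ≤ x with hP
  have hdiv : ∀ k ∈ tauIndices x, ∀ p ∈ k.divisorsAntidiagonal, p ∈ P := by
    rintro k hk ⟨d, m⟩ hp
    rw [Nat.mem_divisorsAntidiagonal] at hp
    obtain ⟨rfl, h0⟩ := hp
    obtain ⟨hd, hm⟩ := mul_ne_zero_iff.1 h0
    rw [mem_tauIndices] at hk
    dsimp only at hk hd hm
    have h1 : d * (m * tau m) ≤ d * m * tau (d * m) := by
      rw [← mul_assoc]; exact Nat.mul_le_mul_left _ (tau_le_tau_mul hd hm)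
    have h2 : (d : ℝ) * ((m * tau m : ℕ) : ℝ) ≤ x := le_trans (by exact_mod_cast h1) hk.2
    have hm' : m * tau m ≠ 0 := mul_ne_zero hm (tau_pos hm).ne'
    simp only [hP, mem_filter, mem_product, mem_Icc, mem_tauIndices]
    refine ⟨⟨⟨by omega, Nat.le_floor (le_trans ?_ h2)⟩, by omega, le_trans ?_ h2⟩, h2⟩
    · exact_mod_cast Nat.le_mul_of_pos_right d (Nat.pos_of_ne_zero hm')
    · exact_mod_cast Nat.le_mul_of_pos_left _ (Nat.pos_of_ne_zero hd)
  calc ∑ k ∈ tauIndices x, Real.log k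
      = ∑ k ∈ tauIndices x, ∑ p ∈ k.divisorsAntidiagonal with p ∈ P, Λ p.1 := by
        refine sum_congr rfl fun k hk => ?_
        rw [filter_true_of_mem (hdiv k hk),
          Nat.sum_divisorsAntidiagonal fun d _ => Λ d, vonMangoldt_sum]
    _ = ∑ p ∈ P with p.1 * p.2 ∈ tauIndices x, Λ p.1 := by
        rw [sum_product_eq_sum_divisorsAntidiagonal _ (tauIndices x)
          (fun p hp => (mem_filter.1 hp).2)
          (fun n hn => by rw [mem_tauIndices] at hn; omega)]
        refine sum_congr rfl fun k hk => sum_congr ?_ fun _ _ => rfl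
        ext p
        simp only [mem_filter, Nat.mem_divisorsAntidiagonal]
        constructor
        · rintro ⟨⟨h1, h2⟩, h3⟩
          exact ⟨⟨h1, h2⟩, h3, h1 ▸ hk⟩
        · tauto
    _ ≤ ∑ p ∈ P, Λ p.1 :=
        sum_le_sum_of_subset_of_nonneg (filter_subset _ _) fun _ _ _ => vonMangoldt_nonneg
    _ = ∑ m ∈ tauIndices x, ∑ d ∈ Icc 1 ⌊x⌋₊,
          if d * ((m * tau m : ℕ) : ℝ) ≤ x then Λ d else 0 := by
        rw [hP, sum_filter, sum_product_right]
    _ ≤ _ := by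
        refine sum_le_sum fun m hm => ?_
        rw [mem_tauIndices] at hm
        have hm' : (0 : ℝ) < ((m * tau m : ℕ) : ℝ) := by
          exact_mod_cast Nat.mul_pos hm.1 (tau_pos (by omega))
        rw [← sum_filter, Chebyshev.psi]
        refine sum_le_sum_of_subset_of_nonneg (fun d hd => ?_) fun _ _ _ => vonMangoldt_nonneg
        simp only [mem_filter, mem_Icc, mem_Ioc] at hd ⊢
        exact ⟨hd.1.1, Nat.le_floor ((le_div_iff₀ hm').2 hd.2)⟩

theorem sum_log_tauIndices_le_mul_sqrt {x : ℝ} (hx : 1 ≤ x) :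
    ∑ k ∈ tauIndices x, Real.log k ≤
      (Real.log 4 + 4) * x * √(1 + 2 * Real.log x) := by
  have hc : 0 ≤ Real.log 4 + 4 := by positivity
  calc _ ≤ _ := sum_log_tauIndices_le x
    _ ≤ ∑ m ∈ tauIndices x, (Real.log 4 + 4) * x * (1 / ((m * tau m : ℕ) : ℝ)) := by
        refine sum_le_sum fun m _ => ?_
        rw [mul_assoc, mul_one_div]
        exact Chebyshev.psi_le_const_mul_self (by positivity)
    _ ≤ (Real.log 4 + 4) * x * ∑ m ∈ Icc 1 ⌊x⌋₊, 1 / ((m * tau m : ℕ) : ℝ) := by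
        rw [← mul_sum]
        refine mul_le_mul_of_nonneg_left ?_ (by positivity)
        exact sum_le_sum_of_subset_of_nonneg (filter_subset _ _) fun _ _ _ => by positivity
    _ ≤ _ := by
        refine mul_le_mul_of_nonneg_left (Real.le_sqrt_of_sq_le ?_) (by positivity)
        refine (sq_sum_inv_mul_tau_le _).trans ?_
        have : 0 < ⌊x⌋₊ := Nat.floor_pos.2 hx
        gcongr
        exact Nat.floor_le (by linarith)

/-- There are at most √x indices k ≤ √x; for the others log x ≤ 2 log k. -/
theorem card_tauIndices_mul_log_le {x : ℝ} (hx : 1 ≤ x) :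
    #(tauIndices x) * Real.log x ≤
      √x * Real.log x + 2 * ∑ k ∈ tauIndices x, Real.log k := by
  have hlog := Real.log_nonneg hx
  have hnn : ∀ k ∈ tauIndices x, 0 ≤ Real.log k := fun k _ => Real.log_natCast_nonneg k
  have hsmall : (#((tauIndices x).filter fun k : ℕ => (k : ℝ) ≤ √x) : ℝ) ≤ √x := by
    refine le_trans ?_ (Nat.floor_le (Real.sqrt_nonneg x))
    have : ((tauIndices x).filter fun k : ℕ => (k : ℝ) ≤ √x) ⊆ Icc 1 ⌊√x⌋₊ := fun k hk => by
      simp only [mem_filter, mem_tauIndices, mem_Icc] at hk ⊢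
      exact ⟨hk.1.1, Nat.le_floor hk.2⟩
    simpa using card_le_card this
  have hlarge : (#((tauIndices x).filter fun k : ℕ => ¬ (k : ℝ) ≤ √x) : ℝ) * Real.log x ≤
      2 * ∑ k ∈ tauIndices x, Real.log k := by
    calc _ = ∑ k ∈ (tauIndices x).filter fun k : ℕ => ¬ (k : ℝ) ≤ √x, Real.log x := by simp
      _ ≤ ∑ k ∈ (tauIndices x).filter fun k : ℕ => ¬ (k : ℝ) ≤ √x, 2 * Real.log k := by
          refine sum_le_sum fun k hk => ?_
          have h := (mem_filter.1 hk).2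
          have : Real.log √x ≤ Real.log k :=
            Real.log_le_log (Real.sqrt_pos.2 (by linarith)) (not_le.1 h).le
          rw [Real.log_sqrt (by linarith)] at this
          linarith
      _ ≤ _ := by
          rw [← mul_sum]
          refine mul_le_mul_of_nonneg_left ?_ two_pos.le
          exact sum_le_sum_of_subset_of_nonneg (filter_subset _ _) fun k hk _ => hnn k hk
  have hcard := card_filter_add_card_filter_not (s := tauIndices x) (fun k : ℕ => (k : ℝ) ≤ √x)
  rw [← hcard]
  push_cast
  rw [add_mul]
  exact add_le_add (mul_le_mul_of_nonneg_right hsmall hlog) hlarge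

theorem NTimes_tau_le {x : ℝ} (hx : 2 ≤ x) :
    (NTimes tau x : ℝ) ≤ (1 + 4 * (Real.log 4 + 4)) * (x / √(Real.log x)) := by
  set L := Real.log x with hL
  have hc : 0 ≤ Real.log 4 + 4 := by positivity
  have hL2 : 1 / 2 ≤ L := by
    have := Real.log_le_log two_pos hx
    have := Real.log_two_gt_d9
    linarith
  have hs : 0 < √L := Real.sqrt_pos.2 (by linarith)
  have hss : √L * √L = L := Real.mul_self_sqrt (by linarith)
  have h1 := card_tauIndices_mul_log_le (x := x) (by linarith)
  have h2 := sum_log_tauIndices_le_mul_sqrt (x := x) (by linarith)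
  have h3 : √(1 + 2 * L) ≤ 2 * √L := by
    rw [Real.sqrt_le_left (by positivity)]
    nlinarith
  have h4 : √x * L ≤ x * √L := by
    have h5 : √L ≤ √x := Real.sqrt_le_sqrt ((Real.log_le_sub_one_of_pos (by linarith)).trans
      (by linarith))
    calc √x * L = √x * √L * √L := by rw [mul_assoc, hss]
      _ ≤ √x * √x * √L := by gcongr
      _ = _ := by rw [Real.mul_self_sqrt (by linarith)]
  have h5 : (Real.log 4 + 4) * x * √(1 + 2 * L) ≤ (Real.log 4 + 4) * x * (2 * √L) :=
    mul_le_mul_of_nonneg_left h3 (by positivity)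
  have h6 : (#(tauIndices x) : ℝ) * L ≤ (1 + 4 * (Real.log 4 + 4)) * x * √L := by
    linarith
  refine (Nat.cast_le.2 (NTimes_tau_le_card x)).trans ?_
  rw [← mul_div_assoc, le_div_iff₀ hs]
  refine le_of_mul_le_mul_right ?_ hs
  rw [mul_assoc, hss]
  exact h6

/-! ### Odd squarefree integers -/

theorem tau_mul_of_coprime {a b : ℕ} (h : a.Coprime b) : tau (a * b) = tau a * tau b :=
  h.card_divisors_mul

theorem tau_prime {p : ℕ} (hp : p.Prime) : tau p = 2 := by
  rw [tau, hp.divisors, card_pair hp.one_lt.ne]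

theorem tau_of_squarefree {m : ℕ} (hm : Squarefree m) : tau m = 2 ^ #m.primeFactors := by
  rw [tau, Nat.card_divisors hm.ne_zero, prod_congr rfl (g := fun _ => 2), prod_const]
  intro p hp
  have h1 := hm.natFactorization_le_one p
  have h2 := (Nat.prime_of_mem_primeFactors hp).factorization_pos_of_dvd hm.ne_zero
    (Nat.dvd_of_mem_primeFactors hp)
  omega

/-- Here τ(a) is a power of 2, so a is the odd part of a τ(a). -/
theorem eq_of_mul_tau_eq_of_odd_of_squarefree {a b : ℕ} (ha : Odd a) (ha' : Squarefree a) (hb : Odd b)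
    (hb' : Squarefree b) (h : a * tau a = b * tau b) : a = b := by
  rw [tau_of_squarefree ha', tau_of_squarefree hb'] at h
  refine Nat.dvd_antisymm ?_ ?_
  · exact (Nat.Coprime.pow_right _ (Nat.coprime_two_right.2 ha)).dvd_of_dvd_mul_right
      (h ▸ dvd_mul_right _ _)
  · exact (Nat.Coprime.pow_right _ (Nat.coprime_two_right.2 hb)).dvd_of_dvd_mul_right
      (h.symm ▸ dvd_mul_right _ _)

/-- The odd squarefree integers in `[1, w]`. -/
def oddSquarefree (w : ℕ) : Finset ℕ := {m ∈ Icc 1 w | Odd m ∧ Squarefree m}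

theorem mem_oddSquarefree {w m : ℕ} :
    m ∈ oddSquarefree w ↔ m ≤ w ∧ Odd m ∧ Squarefree m := by
  simp only [oddSquarefree, mem_filter, mem_Icc]
  exact ⟨fun h => ⟨h.1.2, h.2⟩, fun h => ⟨⟨h.2.1.pos, h.1⟩, h.2⟩⟩

/-- Factors of a squarefree n are coprime, so each of its τ(n) factorisations contributes exactly
1/(n τ(n)); pairs with product outside the set are dropped. -/
theorem sum_inv_oddSquarefree_le_sq (w : ℕ) :
    ∑ n ∈ oddSquarefree w, (1 / n : ℝ) ≤
      (∑ m ∈ oddSquarefree w, 1 / ((m * tau m : ℕ) : ℝ)) ^ 2 := by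
  set A := oddSquarefree w with hA
  rw [sq, sum_mul_sum, ← sum_product']
  refine le_trans ?_ (sum_le_sum_of_subset_of_nonneg
    (filter_subset (fun p : ℕ × ℕ => p.1 * p.2 ∈ A) _) fun _ _ _ => by positivity)
  rw [sum_product_eq_sum_divisorsAntidiagonal _ A (fun p hp => (mem_filter.1 hp).2)
    (fun n hn => (mem_oddSquarefree.1 hn).2.2.ne_zero)]
  refine le_of_eq (sum_congr rfl fun n hn => ?_)
  obtain ⟨hnw, hodd, hsq⟩ := mem_oddSquarefree.1 hn
  have hn0 := hsq.ne_zero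
  have ht : (0 : ℝ) < tau n := by exact_mod_cast tau_pos hn0
  have hnpos : (0 : ℝ) < n := by positivity
  rw [filter_true_of_mem]
  · trans ∑ p ∈ n.divisorsAntidiagonal, (1 / (n * tau n) : ℝ)
    · rw [sum_const, ← Nat.map_div_right_divisors, card_map, nsmul_eq_mul]
      change _ = (tau n : ℝ) * _
      field_simp
    · refine sum_congr rfl fun p hp => ?_
      obtain ⟨rfl, -⟩ := Nat.mem_divisorsAntidiagonal.1 hp
      rw [one_div_mul_one_div, ← Nat.cast_mul, ← Nat.cast_mul,
        tau_mul_of_coprime (Nat.coprime_of_squarefree_mul hsq), mul_mul_mul_comm]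
  · intro p hp
    obtain ⟨rfl, -⟩ := Nat.mem_divisorsAntidiagonal.1 hp
    obtain ⟨h1, h2⟩ := Nat.odd_mul.1 hodd
    refine mem_filter.2 ⟨mem_product.2 ?_, hn⟩
    rw [hA, mem_oddSquarefree, mem_oddSquarefree]
    exact ⟨⟨(Nat.le_mul_of_pos_right _ h2.pos).trans hnw, h1, hsq.of_mul_left⟩,
      (Nat.le_mul_of_pos_left _ h1.pos).trans hnw, h2, hsq.of_mul_right⟩

theorem exists_eq_oddSquarefree_mul {w n : ℕ} (hn : n ∈ Icc 1 w) :
    ∃ s ∈ oddSquarefree w, ∃ e ∈ Icc 1 2, ∃ b ∈ Icc 1 w, s * (e * b ^ 2) = n := by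
  rw [mem_Icc] at hn
  obtain ⟨a, b, ha, hb, hab, hsq⟩ := Nat.sq_mul_squarefree_of_pos (n := n) (by omega)
  have hbn : b ≤ n := by
    rw [← hab]
    exact (Nat.le_self_pow two_ne_zero b).trans (Nat.le_mul_of_pos_right _ ha)
  have han : a ≤ n := by
    rw [← hab]
    exact Nat.le_mul_of_pos_left _ (by positivity)
  rcases Nat.even_or_odd a with he | ho
  · obtain ⟨s, rfl⟩ := he.two_dvd
    refine ⟨s, mem_oddSquarefree.2 ⟨by omega, ?_, hsq.of_mul_right⟩, 2, by simp, b,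
      mem_Icc.2 ⟨hb, by omega⟩, by rw [← hab]; ring⟩
    exact Nat.coprime_two_left.1 (Nat.coprime_of_squarefree_mul hsq)
  · exact ⟨a, mem_oddSquarefree.2 ⟨by omega, ho, hsq⟩, 1, by simp, b,
      mem_Icc.2 ⟨hb, by omega⟩, by rw [← hab]; ring⟩

theorem sum_Icc_inv_sq_le (w : ℕ) : ∑ b ∈ Icc 1 w, (1 / (b : ℝ) ^ 2) ≤ 2 := by
  have h := sum_Ioo_inv_sq_le (α := ℝ) 0 (w + 1)
  have he : Ioo 0 (w + 1) = Icc 1 w := by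
    ext b; simp only [mem_Ioo, mem_Icc]; omega
  rw [he] at h
  simpa using h

/-- Writing n = s e b² with s odd squarefree and e ∈ {1, 2} bounds the harmonic sum by a product; 3
= (1 + 1/2) · 2. -/
theorem log_le_sum_inv_oddSquarefree (w : ℕ) :
    Real.log (w + 1 : ℕ) ≤ 3 * ∑ s ∈ oddSquarefree w, (1 / s : ℝ) := by
  set A := oddSquarefree w
  set T := A ×ˢ (Icc 1 2 ×ˢ Icc 1 w)
  choose! s hs e he b hb h using fun n (hn : n ∈ Icc 1 w) => exists_eq_oddSquarefree_mul hn
  set g : ℕ → ℕ × ℕ × ℕ := fun n => (s n, e n, b n)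
  have hg : Set.InjOn g (Icc 1 w) := fun n hn n' hn' hnn' => by
    simp only [g, Prod.mk.injEq] at hnn'
    rw [← h n hn, ← h n' hn', hnn'.1, hnn'.2.1, hnn'.2.2]
  calc Real.log (w + 1 : ℕ) ≤ ∑ n ∈ Icc 1 w, (1 / n : ℝ) := by
        rw [sum_Icc_inv_eq_harmonic]; exact log_add_one_le_harmonic w
    _ = ∑ q ∈ (Icc 1 w).image g, (1 / ((q.1 * (q.2.1 * q.2.2 ^ 2) : ℕ) : ℝ)) := by
        rw [sum_image hg]
        exact sum_congr rfl fun n hn => by rw [h n hn]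
    _ ≤ ∑ q ∈ T, (1 / ((q.1 * (q.2.1 * q.2.2 ^ 2) : ℕ) : ℝ)) := by
        refine sum_le_sum_of_subset_of_nonneg (fun q hq => ?_) fun _ _ _ => by positivity
        obtain ⟨n, hn, rfl⟩ := mem_image.1 hq
        exact mem_product.2 ⟨hs n hn, mem_product.2 ⟨he n hn, hb n hn⟩⟩
    _ = (∑ s ∈ A, (1 / s : ℝ)) *
          ((∑ e ∈ Icc (1 : ℕ) 2, (1 / e : ℝ)) * ∑ b ∈ Icc 1 w, (1 / (b : ℝ) ^ 2)) := by
        rw [sum_mul_sum, ← sum_product', sum_mul_sum, ← sum_product']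
        refine sum_congr rfl fun q _ => ?_
        push_cast
        rw [one_div_mul_one_div, one_div_mul_one_div]
    _ ≤ (∑ s ∈ A, (1 / s : ℝ)) * ((3 / 2) * 2) := by
        have h2 : ∑ e ∈ Icc (1 : ℕ) 2, (1 / e : ℝ) = 3 / 2 := by
          rw [sum_Icc_succ_top (by norm_num)]; norm_num
        rw [h2]
        gcongr
        exact sum_Icc_inv_sq_le w
    _ = _ := by ring

theorem sqrt_log_le_sum_inv_mul_tau (w : ℕ) :
    √(Real.log (w + 1 : ℕ) / 3) ≤ ∑ m ∈ oddSquarefree w, 1 / ((m * tau m : ℕ) : ℝ) := by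
  rw [Real.sqrt_le_left (sum_nonneg fun _ _ => by positivity)]
  linarith [log_le_sum_inv_oddSquarefree w, sum_inv_oddSquarefree_le_sq w]

/-! ### Primes in intervals -/

theorem half_le_primeCounting_mul_log {y : ℝ} (hy : 32 ≤ y) :
    y / 2 ≤ Nat.primeCounting ⌊y⌋₊ * Real.log y := by
  have h := Chebyshev.pi_ge' (x := y) (by linarith)
  rw [div_le_iff₀ (Real.log_pos (by linarith))] at h
  -- Tangent line to log at 32.
  have h1 : Real.log (y + 2) ≤ (y + 2) / 32 - 1 + 5 * Real.log 2 := by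
    have h3 := Real.log_le_sub_one_of_pos (x := (y + 2) / 32) (by linarith)
    have h4 : Real.log 32 = 5 * Real.log 2 := by
      rw [show (32 : ℝ) = 2 ^ 5 by norm_num, Real.log_pow]; norm_num
    rw [Real.log_div (by linarith) (by norm_num), h4] at h3
    linarith
  nlinarith [Real.log_two_gt_d9, Real.log_two_lt_d9]

/-- The primes in `(z, y]`. -/
noncomputable def primesBetween (z y : ℝ) : Finset ℕ :=
  (Nat.primesLE ⌊y⌋₊).filter fun p => z < p

theorem mem_primesBetween {z y : ℝ} {p : ℕ} :
    p ∈ primesBetween z y ↔ p.Prime ∧ z < p ∧ (p : ℝ) ≤ y := by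
  rw [primesBetween, mem_filter, Nat.mem_primesLE]
  constructor
  · rintro ⟨⟨h1, h2⟩, h3⟩
    exact ⟨h2, h3, (Nat.le_floor_iff' h2.ne_zero).1 h1⟩
  · rintro ⟨h1, h2, h3⟩
    exact ⟨⟨Nat.le_floor h3, h1⟩, h2⟩

theorem primeCounting_le_card_primesBetween_add {z : ℝ} (hz : 0 ≤ z) (y : ℝ) :
    (Nat.primeCounting ⌊y⌋₊ : ℝ) ≤ #(primesBetween z y) + z := by
  rw [← Nat.primesLE_card_eq_primeCounting,
    ← card_filter_add_card_filter_not (fun p : ℕ => z < p), Nat.cast_add]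
  refine add_le_add le_rfl (le_trans ?_ (Nat.floor_le hz))
  have : ((Nat.primesLE ⌊y⌋₊).filter fun p : ℕ => ¬ z < p) ⊆ Icc 1 ⌊z⌋₊ := fun p hp => by
    simp only [mem_filter, Nat.mem_primesLE, mem_Icc, not_lt] at hp ⊢
    exact ⟨hp.1.2.pos, Nat.le_floor hp.2⟩
  simpa using card_le_card this

theorem div_log_le_card_primesBetween {t y : ℝ} (ht : 64 ≤ t) (hy : t ^ 6 / 2 ≤ y)
    (hy' : y ≤ t ^ 8) : y / (32 * Real.log t) ≤ #(primesBetween (t ^ 4) y) := by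
  have hlog : 0 < Real.log t := Real.log_pos (by linarith)
  have hlog' : Real.log t ≤ t := (Real.log_le_sub_one_of_pos (by linarith)).trans (by linarith)
  have ht4 : 0 < t ^ 4 := by positivity
  have h32 : 32 ≤ y := by
    have : (64 : ℝ) ^ 6 ≤ t ^ 6 := by gcongr
    linarith
  have h1 := half_le_primeCounting_mul_log h32
  have h2 := primeCounting_le_card_primesBetween_add ht4.le y
  have h3 : Real.log y ≤ 8 * Real.log t := by
    have := Real.log_le_log (by linarith) hy'
    rwa [Real.log_pow] at this
  have h4 : y / 2 ≤ (#(primesBetween (t ^ 4) y) + t ^ 4) * (8 * Real.log t) :=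
    h1.trans (mul_le_mul h2 h3 (Real.log_nonneg (by linarith)) (by positivity))
  -- Removing the primes up to t⁴ costs at most half of the main term y / (16 log t).
  have h5 : t ^ 4 * (64 * Real.log t) ≤ t ^ 6 := by
    have : 64 * Real.log t ≤ t ^ 2 := by nlinarith
    calc _ ≤ t ^ 4 * t ^ 2 := by gcongr
      _ = _ := by ring
  rw [div_le_iff₀ (by positivity)]
  nlinarith

/-! ### Lower bound -/

theorem NTimes_tau_ge_sum {t : ℝ} (ht : 1 ≤ t) :
    ∑ m ∈ oddSquarefree ⌊t⌋₊,
      #(primesBetween (t ^ 4) (t ^ 8 / (2 * ((m * tau m : ℕ) : ℝ)))) ≤ NTimes tau (t ^ 8) := by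
  have ht4 : t ^ 2 ≤ t ^ 4 := pow_le_pow_right₀ ht (by norm_num)
  have hFle : ∀ m ∈ oddSquarefree ⌊t⌋₊, ((m * tau m : ℕ) : ℝ) ≤ t ^ 2 := fun m hm => by
    have hmt : (m : ℝ) ≤ t := (Nat.le_floor_iff (by linarith)).1 (mem_oddSquarefree.1 hm).1
    have : (tau m : ℝ) ≤ m := by exact_mod_cast tau_le_self m
    push_cast
    rw [sq]
    gcongr
    linarith
  rw [← card_sigma, NTimes]
  set Q := (oddSquarefree ⌊t⌋₊).sigma fun m =>
    primesBetween (t ^ 4) (t ^ 8 / (2 * ((m * tau m : ℕ) : ℝ))) with hQ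
  have hmem : ∀ q ∈ Q, Odd q.1 ∧ Squarefree q.1 ∧ ((q.1 * tau q.1 : ℕ) : ℝ) < q.2 ∧
      q.2.Prime ∧ 0 < q.1 * tau q.1 ∧
      (q.2 : ℝ) ≤ t ^ 8 / (2 * ((q.1 * tau q.1 : ℕ) : ℝ)) := by
    rintro ⟨m, p⟩ hq
    rw [hQ, mem_sigma, mem_primesBetween] at hq
    obtain ⟨hm, hp, h1, h2⟩ := hq
    obtain ⟨-, ho, hs⟩ := mem_oddSquarefree.1 hm
    exact ⟨ho, hs, (hFle m hm).trans_lt (ht4.trans_lt h1), hp,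
      Nat.mul_pos ho.pos (tau_pos hs.ne_zero), h2⟩
  have htau : ∀ q ∈ Q, q.1 * q.2 * tau (q.1 * q.2) = 2 * (q.2 * (q.1 * tau q.1)) := fun q hq => by
    obtain ⟨-, -, h1, hp, h0, -⟩ := hmem q hq
    have hlt : q.1 < q.2 := by
      refine lt_of_le_of_lt ?_ (Nat.cast_lt.1 h1)
      exact Nat.le_mul_of_pos_right _ (Nat.pos_of_mul_pos_left h0)
    have hcop : q.1.Coprime q.2 :=
      (Nat.coprime_of_lt_prime (Nat.pos_of_mul_pos_right h0).ne' hlt hp).symm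
    rw [tau_mul_of_coprime hcop, tau_prime hp]
    ring
  -- Each prime exceeds its own m τ(m). If the primes differ, q.2 divides r.1 τ(r.1) < r.2;
  -- exchanging q and r then gives a contradiction.
  have hprime : ∀ q ∈ Q, ∀ r ∈ Q, q.2 ≠ r.2 →
      q.2 * (q.1 * tau q.1) = r.2 * (r.1 * tau r.1) → q.2 < r.2 := fun q hq r hr hne heq => by
    obtain ⟨-, -, -, hp, -, -⟩ := hmem q hq
    obtain ⟨-, -, h1, hp', h0, -⟩ := hmem r hr
    rcases hp.dvd_mul.1 (heq ▸ dvd_mul_right q.2 _) with h | h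
    · exact absurd ((Nat.prime_dvd_prime_iff_eq hp hp').1 h) hne
    · exact (Nat.le_of_dvd h0 h).trans_lt (Nat.cast_lt.1 h1)
  have hinj : Set.InjOn (fun q : (_ : ℕ) × ℕ => q.1 * q.2 * tau (q.1 * q.2)) Q := by
    intro q hq r hr h
    dsimp only at h
    rw [htau q hq, htau r hr] at h
    have h' : q.2 * (q.1 * tau q.1) = r.2 * (r.1 * tau r.1) := by omega
    obtain ⟨ho, hs, -, hp, -, -⟩ := hmem q hq
    obtain ⟨ho', hs', -, -, -, -⟩ := hmem r hr
    have h2 : q.2 = r.2 := by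
      by_contra hne
      exact lt_asymm (hprime q hq r hr hne h') (hprime r hr q hq (Ne.symm hne) h'.symm)
    rw [← h2] at h'
    have h1 := eq_of_mul_tau_eq_of_odd_of_squarefree ho hs ho' hs' (Nat.eq_of_mul_eq_mul_left hp.pos h')
    exact Sigma.ext h1 (heq_of_eq h2)
  rw [← card_image_of_injOn hinj, ← Set.ncard_coe_finset]
  refine Set.ncard_le_ncard (fun n hn => ?_) (timesSet_finite _ _)
  obtain ⟨q, hq, rfl⟩ := mem_image.1 (mem_coe.1 hn)
  obtain ⟨ho, -, -, hp, h0, hle⟩ := hmem q hq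
  have hk : 0 < q.1 * q.2 := Nat.mul_pos ho.pos hp.pos
  refine ⟨Nat.mul_pos hk (tau_pos hk.ne'), ?_, q.1 * q.2, hk, rfl⟩
  have h0' : (0 : ℝ) < 2 * ((q.1 * tau q.1 : ℕ) : ℝ) := by
    have : (0 : ℝ) < ((q.1 * tau q.1 : ℕ) : ℝ) := Nat.cast_pos.2 h0
    linarith
  rw [le_div_iff₀ h0'] at hle
  rw [htau q hq, Nat.cast_mul, Nat.cast_mul]
  push_cast at hle ⊢
  linarith

theorem NTimes_tau_ge_of_large {t : ℝ} (ht : 64 ≤ t) :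
    t ^ 8 / (64 * Real.log t) * √(Real.log t / 3) ≤ NTimes tau (t ^ 8) := by
  have hlog : 0 < Real.log t := Real.log_pos (by linarith)
  have ht0 : 0 < t := by linarith
  calc _ ≤ t ^ 8 / (64 * Real.log t) *
        ∑ m ∈ oddSquarefree ⌊t⌋₊, 1 / ((m * tau m : ℕ) : ℝ) := by
        gcongr
        refine le_trans ?_ (sqrt_log_le_sum_inv_mul_tau _)
        gcongr
        push_cast
        exact (Nat.lt_floor_add_one t).le
    _ ≤ ∑ m ∈ oddSquarefree ⌊t⌋₊,
        (#(primesBetween (t ^ 4) (t ^ 8 / (2 * ((m * tau m : ℕ) : ℝ)))) : ℝ) := by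
        rw [mul_sum]
        refine sum_le_sum fun m hm => ?_
        obtain ⟨hmt, ho, hs⟩ := mem_oddSquarefree.1 hm
        have hmt' : (m : ℝ) ≤ t := (Nat.le_floor_iff ht0.le).1 hmt
        have hF1 : (1 : ℝ) ≤ ((m * tau m : ℕ) : ℝ) := by
          exact_mod_cast Nat.mul_pos ho.pos (tau_pos hs.ne_zero)
        have hF2 : ((m * tau m : ℕ) : ℝ) ≤ t ^ 2 := by
          have h1 : ((m * tau m : ℕ) : ℝ) ≤ m * m := by
            exact_mod_cast Nat.mul_le_mul_left m (tau_le_self m)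
          exact h1.trans (by rw [sq]; gcongr)
        generalize ((m * tau m : ℕ) : ℝ) = F at hF1 hF2 ⊢
        refine le_trans (le_of_eq ?_) (div_log_le_card_primesBetween ht ?_ ?_)
        · field_simp
          norm_num
        · rw [div_le_div_iff₀ two_pos (by linarith)]
          calc t ^ 6 * (2 * F) ≤ t ^ 6 * (2 * t ^ 2) := by gcongr
            _ = _ := by ring
        · exact div_le_self (by positivity) (by linarith)
    _ ≤ _ := by exact_mod_cast NTimes_tau_ge_sum (by linarith)

theorem one_le_NTimes_tau {x : ℝ} (hx : 1 ≤ x) : 1 ≤ NTimes tau x := by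
  refine (Set.ncard_pos (timesSet_finite _ _)).2 ⟨1, le_rfl, by simpa using hx, 1, le_rfl, ?_⟩
  simp [tau]

theorem NTimes_tau_ge {x : ℝ} (hx : 2 ≤ x) :
    1 / (2 * 64 ^ 8) * (x / √(Real.log x)) ≤ NTimes tau x := by
  have hx0 : 0 < x := by linarith
  have hL : 1 / 4 ≤ Real.log x := by
    have := Real.log_le_log two_pos hx
    have := Real.log_two_gt_d9
    linarith
  have hL0 : 0 < Real.log x := by linarith
  have hs : 0 < √(Real.log x) := Real.sqrt_pos.2 hL0
  -- Below 64⁸ the single value n = 1 suffices; above it, t = x^(1/8) ≥ 64.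
  rcases le_total x (64 ^ 8) with h | h
  · refine le_trans ?_ (Nat.one_le_cast.2 (one_le_NTimes_tau (by linarith)))
    have h2 : 1 / 2 ≤ √(Real.log x) := Real.le_sqrt_of_sq_le (by linarith)
    rw [← mul_div_assoc, div_le_one hs]
    linarith
  · set t := x ^ (1 / 8 : ℝ) with ht
    have ht8 : t ^ 8 = x := by
      rw [ht, ← Real.rpow_natCast, ← Real.rpow_mul hx0.le]; norm_num
    have ht0 : 0 ≤ t := by positivity
    have ht64 : 64 ≤ t := le_of_pow_le_pow_left₀ (by norm_num) ht0 (ht8.symm ▸ h)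
    have hlogt : Real.log t = Real.log x / 8 := by
      rw [ht, Real.log_rpow hx0]; ring
    have key := NTimes_tau_ge_of_large ht64
    rw [ht8, hlogt] at key
    refine le_trans ?_ key
    -- √24 ≤ 5; with 64/8 = 8 this produces the 1/40 below.
    have h5 : √(Real.log x) / 5 ≤ √(Real.log x / 8 / 3) := by
      refine Real.le_sqrt_of_sq_le ?_
      rw [div_pow, Real.sq_sqrt hL0.le]
      linarith
    calc _ ≤ 1 / 40 * (x / √(Real.log x)) := by gcongr; norm_num
      _ = x / (64 * (Real.log x / 8)) * (√(Real.log x) / 5) := by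
          have := Real.mul_self_sqrt hL0.le
          field_simp
          nlinarith
      _ ≤ _ := by gcongr

theorem theorem1p1 :
    ∃ c C : ℝ, 0 < c ∧ 0 < C ∧ ∀ x : ℝ, 2 ≤ x →
      c * (x / (Real.log x) ^ (1 / 2 : ℝ)) ≤ (NTimes tau x : ℝ) ∧
        (NTimes tau x : ℝ) ≤ C * (x / (Real.log x) ^ (1 / 2 : ℝ)) := by
  refine ⟨1 / (2 * 64 ^ 8), 1 + 4 * (Real.log 4 + 4), by positivity, by positivity,
    fun x hx => ?_⟩
  rw [← Real.sqrt_eq_rpow]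
  exact ⟨NTimes_tau_ge hx, NTimes_tau_le hx⟩
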